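/- Let $A=A_1+\mathrm{i}A_2\in\mathbb{C}^{n\times n}$ be invertible, with $A_1,A_2\in\mathbb{R}^{n\times n}$, and put $$A^{\lozenge}=\begin{bmatrix}A_2&A_1\\A_1&-A_2\end{bmatrix}\in\mathbb{R}^{2n\times 2n}.$$ Write $A^{*}$ for the conjugate transpose of $A$, $\overline{X}$ for the entrywise complex conjugate of $X$, and $\omega(M)=\max\{|x^{*}Mx| : x\in\mathbb{C}^{m},\ \|x\|_2=1\}$ for the numerical radius of an $m\times m$ matrix $M$. Then the matrix equation $$X+A^{*}\,\overline{X}^{-1}A=I_n$$ has a (Hermitian) positive definite solution $X\in\mathbb{C}^{n\times n}$ if and only if $\omega(A^{\lozenge})\le\frac12$. -/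

import Mathlib

open Matrix
open scoped ComplexOrder

/-- For `A = A₁ + i A₂` with `A₁`, `A₂` real, the real block matrix `[A₂, A₁; A₁, -A₂]`. -/
def lozenge {m n : Type*} (A : Matrix m n ℂ) : Matrix (m ⊕ m) (n ⊕ n) ℝ :=
  Matrix.fromBlocks (A.map Complex.im) (A.map Complex.re)
    (A.map Complex.re) (-(A.map Complex.im))

/-- The moduli `|x* M x|`, where `x` runs over the complex vectors of Euclidean norm one. -/
def numericalRangeModuli {ι : Type*} [Fintype ι] (M : Matrix ι ι ℂ) : Set ℝ :=
  {r | ∃ x : EuclideanSpace ℂ ι, ‖x‖ = 1 ∧ r = ‖star x.ofLp ⬝ᵥ (M *ᵥ x.ofLp)‖}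

/-- The numerical radius of a complex square matrix. The supremum is a maximum, see
`isGreatest_numericalRadius`. -/
noncomputable def numericalRadius {ι : Type*} [Fintype ι] (M : Matrix ι ι ℂ) : ℝ :=
  sSup (numericalRangeModuli M)

theorem isGreatest_numericalRadius {ι : Type*} [Fintype ι] [Nonempty ι] (M : Matrix ι ι ℂ) :
    IsGreatest (numericalRangeModuli M) (numericalRadius M) := by
  have himg : numericalRangeModuli M =
      (fun x : EuclideanSpace ℂ ι => ‖star x.ofLp ⬝ᵥ (M *ᵥ x.ofLp)‖) ''
        Metric.sphere (0 : EuclideanSpace ℂ ι) 1 := by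
    ext r
    simp [numericalRangeModuli, eq_comm]
  have hcont : Continuous
      (fun x : EuclideanSpace ℂ ι => ‖star x.ofLp ⬝ᵥ (M *ᵥ x.ofLp)‖) := by
    have h : Continuous (fun x : EuclideanSpace ℂ ι => x.ofLp) :=
      PiLp.continuous_ofLp 2 _
    exact (Continuous.dotProduct h.star (Continuous.matrix_mulVec continuous_const h)).norm
  have hK : IsCompact (numericalRangeModuli M) := by
    rw [himg]
    exact (isCompact_sphere _ _).image hcont
  have hne : (numericalRangeModuli M).Nonempty := by
    rw [himg]
    exact (NormedSpace.sphere_nonempty.mpr zero_le_one).image _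
  exact hK.isGreatest_sSup hne

/-! Write `B` for the complexified lozenge of `A`. It is the block swap times `realRep A`, and
conjugation by the swap turns `realRep X` into `realRep` of the entrywise conjugate. So `realRep`
carries the equation to `Y + Bᴴ Y⁻¹ B = 1`, with no conjugation left. A positive definite solution
bounds the form of `B` by completing the square (`norm_dotProduct_le_of_solution`). Conversely, the
bound makes every block Toeplitz form with symbol `1 + zB + (zB)ᴴ`, `|z| = 1`, nonnegative
(`toeplitzForm_nonneg`). The iterates `riccatiSeq` are Schur complements of these forms, hence stay
above `B Bᴴ`, which is positive definite as `B` is invertible; they decrease, so they converge to a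
solution. Every iterate lies in the closed range of `realRep`, so the limit comes from some `X`. -/

section Toeplitz

/-! ### Positivity of block Toeplitz forms. -/

variable {ι : Type*} [Fintype ι]

theorem star_star_dotProduct_mulVec (M : Matrix ι ι ℂ) (x y : ι → ℂ) :
    star (star x ⬝ᵥ (M *ᵥ y)) = star y ⬝ᵥ (Mᴴ *ᵥ x) := by
  rw [star_dotProduct, star_star, star_mulVec, ← dotProduct_mulVec]

theorem re_star_dotProduct_self_nonneg (x : ι → ℂ) : 0 ≤ (star x ⬝ᵥ x).re :=
  (Complex.nonneg_iff.mp (dotProduct_star_self_nonneg x)).1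

/-- Orthogonality of characters: summing over frequencies `m` keeps only the pairs `l = j + s`. -/
theorem sum_stdAddChar_mul_dotProduct (N : ℕ) [NeZero N] (C : Matrix ι ι ℂ)
    (x : ZMod N → ι → ℂ) (s : ZMod N) :
    ∑ m, ZMod.stdAddChar (-(m * s)) *
        (star (∑ l, ZMod.stdAddChar (m * l) • x l) ⬝ᵥ
          (C *ᵥ ∑ l, ZMod.stdAddChar (m * l) • x l)) =
      N * ∑ j, star (x j) ⬝ᵥ (C *ᵥ x (j + s)) := by
  have expand (m : ZMod N) : ZMod.stdAddChar (-(m * s)) *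
        (star (∑ l, ZMod.stdAddChar (m * l) • x l) ⬝ᵥ
          (C *ᵥ ∑ l, ZMod.stdAddChar (m * l) • x l)) =
      ∑ j, ∑ l, ZMod.stdAddChar (m * (l - (j + s))) * (star (x j) ⬝ᵥ (C *ᵥ x l)) := by
    rw [star_sum, sum_dotProduct, Finset.mul_sum]
    refine Finset.sum_congr rfl fun j _ => ?_
    rw [mulVec_sum, dotProduct_sum, Finset.mul_sum]
    refine Finset.sum_congr rfl fun l _ => ?_
    have hstar : star (ZMod.stdAddChar (m * j)) = ZMod.stdAddChar (-(m * j)) :=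
      (AddChar.map_neg_eq_conj _ _).symm
    rw [star_smul, hstar, mulVec_smul, smul_dotProduct, dotProduct_smul, smul_eq_mul,
      smul_eq_mul, show m * (l - (j + s)) = -(m * s) + (-(m * j) + m * l) by ring,
      AddChar.map_add_eq_mul, AddChar.map_add_eq_mul]
    ring
  simp_rw [expand]
  rw [Finset.sum_comm, Finset.mul_sum]
  refine Finset.sum_congr rfl fun j _ => ?_
  rw [Finset.sum_comm]
  simp_rw [← Finset.sum_mul, AddChar.sum_mulShift _ (ZMod.isPrimitive_stdAddChar N), sub_eq_zero]
  simp [ZMod.card]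

/-- The Fourier transform splits the form into frequencies, each contributing `p*p + 2 Re (χ p*Bp)`
with `|χ| = 1`. -/
theorem cyclic_form_nonneg {B : Matrix ι ι ℂ}
    (hB : ∀ x : ι → ℂ, ‖star x ⬝ᵥ (B *ᵥ x)‖ ≤ 1 / 2 * (star x ⬝ᵥ x).re)
    (N : ℕ) [NeZero N] (x : ZMod N → ι → ℂ) :
    0 ≤ ∑ j, (star (x j) ⬝ᵥ x j).re + 2 * ∑ j, (star (x (j + 1)) ⬝ᵥ (B *ᵥ x j)).re := by
  classical
  have h0 := congrArg Complex.re (sum_stdAddChar_mul_dotProduct N 1 x 0)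
  have h1 := congrArg Complex.re (sum_stdAddChar_mul_dotProduct N B x (-1))
  rw [← Equiv.sum_comp (Equiv.addRight (1 : ZMod N)) fun j => star (x j) ⬝ᵥ (B *ᵥ x (j + -1))] at h1
  simp only [one_mulVec, mul_zero, neg_zero, AddChar.map_zero_eq_one, one_mul, add_zero,
    Complex.re_sum, Equiv.coe_addRight, add_neg_cancel_right, ← Complex.ofReal_natCast, Complex.re_ofReal_mul]
    at h0 h1
  have hN : (0 : ℝ) < N := by exact_mod_cast NeZero.pos N
  refine nonneg_of_mul_nonneg_right ?_ hN
  rw [mul_add, mul_left_comm, ← h0, ← h1, Finset.mul_sum, ← Finset.sum_add_distrib]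
  refine Finset.sum_nonneg fun m _ => ?_
  set p := ∑ l, ZMod.stdAddChar (m * l) • x l
  have h2 := (Complex.abs_re_le_norm (ZMod.stdAddChar (-(m * -1)) * (star p ⬝ᵥ (B *ᵥ p))))
  rw [norm_mul, AddChar.norm_apply, one_mul] at h2
  linarith [hB p, neg_abs_le (ZMod.stdAddChar (-(m * -1)) * (star p ⬝ᵥ (B *ᵥ p))).re]

/-- The quadratic form of the block tridiagonal Toeplitz matrix with `k + 1` diagonal blocks
equal to `1` and off-diagonal blocks `B` and `Bᴴ`. -/
noncomputable def toeplitzForm (B : Matrix ι ι ℂ) (k : ℕ) (x : ℕ → ι → ℂ) : ℝ :=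
  ∑ j ∈ Finset.range (k + 1), (star (x j) ⬝ᵥ x j).re +
    2 * ∑ j ∈ Finset.range k, (star (x (j + 1)) ⬝ᵥ (B *ᵥ x j)).re

theorem toeplitzForm_nonneg {B : Matrix ι ι ℂ}
    (hB : ∀ x : ι → ℂ, ‖star x ⬝ᵥ (B *ᵥ x)‖ ≤ 1 / 2 * (star x ⬝ᵥ x).re)
    (k : ℕ) (x : ℕ → ι → ℂ) : 0 ≤ toeplitzForm B k x := by
  -- One extra zero block kills the wrap-around terms of the cyclic form; `ZMod (k + 2)` unfolds to
  -- `Fin (k + 2)`.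
  let y : Fin (k + 2) → ι → ℂ := Fin.snoc (fun j : Fin (k + 1) => x j) 0
  have hcast (j : Fin (k + 1)) : y j.castSucc = x j := by simp [y]
  have hlast : y (Fin.last (k + 1)) = 0 := by simp [y]
  have h : 0 ≤ ∑ j : Fin (k + 2), (star (y j) ⬝ᵥ y j).re +
      2 * ∑ j : Fin (k + 2), (star (y (j + 1)) ⬝ᵥ (B *ᵥ y j)).re :=
    cyclic_form_nonneg hB (k + 2) y
  simp only [Fin.sum_univ_castSucc (n := k + 1), hcast, hlast] at h
  rw [Fin.sum_univ_castSucc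
    (f := fun j : Fin (k + 1) => (star (y (j.castSucc + 1)) ⬝ᵥ (B *ᵥ x j)).re)] at h
  have h2 : y ((Fin.last k).castSucc + 1) = 0 := by
    rw [← hlast]; congr 1; ext; simp
  have h3 (j : Fin k) : y (j.castSucc.castSucc + 1) = x (j + 1) := by
    have : j.castSucc.castSucc + 1 = j.succ.castSucc := by
      ext; simp
    rw [this, hcast]; simp
  rw [h2] at h
  simp only [h3, star_zero, zero_dotProduct, mulVec_zero, dotProduct_zero, Complex.zero_re,
    add_zero] at h
  simpa [toeplitzForm, Finset.sum_range] using h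

theorem toeplitzForm_succ (B : Matrix ι ι ℂ) (k : ℕ) (x : ℕ → ι → ℂ) :
    toeplitzForm B (k + 1) x =
      (star (x 0) ⬝ᵥ x 0).re + 2 * (star (x 1) ⬝ᵥ (B *ᵥ x 0)).re +
        toeplitzForm B k (fun j => x (j + 1)) := by
  unfold toeplitzForm
  rw [Finset.sum_range_succ' _ (k + 1),
    Finset.sum_range_succ' (fun j => (star (x (j + 1)) ⬝ᵥ (B *ᵥ x j)).re) k]
  ring

end Toeplitz

/-! ### The equation `Y + Bᴴ Y⁻¹ B = 1`. -/

section Riccati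

open Filter Topology

variable {ι : Type*} [Fintype ι]

theorem Matrix.IsHermitian.posDef_of_re_pos {M : Matrix ι ι ℂ} (hM : M.IsHermitian)
    (h : ∀ x : ι → ℂ, x ≠ 0 → 0 < (star x ⬝ᵥ (M *ᵥ x)).re) : M.PosDef := by
  refine .of_dotProduct_mulVec_pos hM fun x hx => Complex.pos_iff.mpr ⟨h x hx, ?_⟩
  have := congrArg Complex.im (star_star_dotProduct_mulVec M x x)
  rw [hM.eq, Complex.star_def, Complex.conj_im] at this
  linarith

theorem Matrix.PosDef.re_dotProduct_nonneg {M : Matrix ι ι ℂ} (hM : M.PosDef) (x : ι → ℂ) :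
    0 ≤ (star x ⬝ᵥ (M *ᵥ x)).re :=
  (Complex.nonneg_iff.mp (hM.posSemidef.dotProduct_mulVec_nonneg x)).1

theorem re_star_dotProduct_comm (x y : ι → ℂ) : (star x ⬝ᵥ y).re = (star y ⬝ᵥ x).re := by
  rw [← Complex.conj_re, ← Complex.star_def, star_dotProduct, star_star]

theorem re_star_dotProduct_self_pos {x : ι → ℂ} (hx : x ≠ 0) : 0 < (star x ⬝ᵥ x).re :=
  (Complex.pos_iff.mp (dotProduct_star_self_pos_iff.mpr hx)).1

theorem polarization (M : Matrix ι ι ℂ) (x y : ι → ℂ) :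
    star x ⬝ᵥ (M *ᵥ y) =
      (star (x + y) ⬝ᵥ (M *ᵥ (x + y)) - star (x - y) ⬝ᵥ (M *ᵥ (x - y)) -
        Complex.I * (star (x + Complex.I • y) ⬝ᵥ (M *ᵥ (x + Complex.I • y))) +
        Complex.I * (star (x - Complex.I • y) ⬝ᵥ (M *ᵥ (x - Complex.I • y)))) / 4 := by
  simp only [star_add, star_sub, star_smul, mulVec_add, mulVec_sub, mulVec_smul, add_dotProduct,
    sub_dotProduct, dotProduct_add, dotProduct_sub, smul_dotProduct, dotProduct_smul, smul_eq_mul,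
    Complex.star_def, Complex.conj_I]
  ring_nf
  simp only [Complex.I_sq]
  ring

variable [DecidableEq ι]

/-- Expand the form of `Z` at `u - Z⁻¹ w`. -/
theorem Matrix.PosDef.two_mul_re_dotProduct_le {Z : Matrix ι ι ℂ} (hZ : Z.PosDef)
    (u w : ι → ℂ) :
    2 * (star u ⬝ᵥ w).re ≤ (star u ⬝ᵥ (Z *ᵥ u)).re + (star w ⬝ᵥ (Z⁻¹ *ᵥ w)).re := by
  have hdet : IsUnit Z.det := (isUnit_iff_isUnit_det Z).mp hZ.isUnit
  have hw : Z *ᵥ (Z⁻¹ *ᵥ w) = w := by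
    rw [mulVec_mulVec, mul_nonsing_inv _ hdet, one_mulVec]
  have h := hZ.re_dotProduct_nonneg (u - Z⁻¹ *ᵥ w)
  have hcross : (star (Z⁻¹ *ᵥ w) ⬝ᵥ (Z *ᵥ u)).re = (star u ⬝ᵥ w).re := by
    have := star_star_dotProduct_mulVec Z (Z⁻¹ *ᵥ w) u
    rw [hZ.isHermitian.eq, hw] at this
    rw [← this, Complex.star_def, Complex.conj_re]
  simp only [star_sub, mulVec_sub, sub_dotProduct, dotProduct_sub, Complex.sub_re, hw,
    hcross] at h
  rw [re_star_dotProduct_comm (Z⁻¹ *ᵥ w) w] at h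
  linarith

theorem Matrix.PosDef.re_dotProduct_inv_antitone {Y Z : Matrix ι ι ℂ} (hY : Y.PosDef)
    (hZ : Z.PosDef)
    (h : ∀ x : ι → ℂ, (star x ⬝ᵥ (Z *ᵥ x)).re ≤ (star x ⬝ᵥ (Y *ᵥ x)).re) (w : ι → ℂ) :
    (star w ⬝ᵥ (Y⁻¹ *ᵥ w)).re ≤ (star w ⬝ᵥ (Z⁻¹ *ᵥ w)).re := by
  have hdet : IsUnit Y.det := (isUnit_iff_isUnit_det Y).mp hY.isUnit
  have hw : Y *ᵥ (Y⁻¹ *ᵥ w) = w := by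
    rw [mulVec_mulVec, mul_nonsing_inv _ hdet, one_mulVec]
  have h1 := hZ.two_mul_re_dotProduct_le (Y⁻¹ *ᵥ w) w
  have h2 := h (Y⁻¹ *ᵥ w)
  rw [hw] at h2
  rw [re_star_dotProduct_comm w]
  linarith

/-- The form bound on `B` implied by a positive definite solution of `Y + Bᴴ Y⁻¹ B = 1`. -/
theorem norm_dotProduct_le_of_solution {B Y : Matrix ι ι ℂ} (hY : Y.PosDef)
    (h : Y + Bᴴ * Y⁻¹ * B = 1) (x : ι → ℂ) :
    ‖star x ⬝ᵥ (B *ᵥ x)‖ ≤ 1 / 2 * (star x ⬝ᵥ x).re := by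
  -- A unimodular `c` rotates `x*Bx` onto its modulus without changing the form of `Y⁻¹` at `B x`.
  obtain ⟨c, hc, hcx⟩ : ∃ c : ℂ, star c * c = 1 ∧
      c * (star x ⬝ᵥ (B *ᵥ x)) = ‖star x ⬝ᵥ (B *ᵥ x)‖ := by
    obtain ⟨c, hc, h⟩ := RCLike.exists_norm_eq_mul_self (star x ⬝ᵥ (B *ᵥ x))
    exact ⟨c, by simp [Complex.conj_mul', hc], h.symm⟩
  have h1 := hY.two_mul_re_dotProduct_le x (c • (B *ᵥ x))
  rw [dotProduct_smul, smul_eq_mul, hcx, Complex.ofReal_re, star_smul, mulVec_smul,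
    smul_dotProduct, dotProduct_smul, smul_smul, hc, one_smul] at h1
  have h2 := congrArg (fun M => (star x ⬝ᵥ (M *ᵥ x)).re) h
  simp only [add_mulVec, dotProduct_add, one_mulVec, Complex.add_re, ← mulVec_mulVec] at h2
  rw [dotProduct_mulVec (star x) Bᴴ, ← star_mulVec] at h2
  linarith

/-- Each quadratic form decreases and is bounded below by `0`; polarization at basis vectors
recovers the entries. -/
theorem exists_tendsto_of_antitone_form {Y : ℕ → Matrix ι ι ℂ} (hY : ∀ k, (Y k).PosDef)
    (h : ∀ x : ι → ℂ, Antitone fun k => (star x ⬝ᵥ (Y k *ᵥ x)).re) :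
    ∃ L, Tendsto Y atTop (𝓝 L) := by
  have hq (x : ι → ℂ) : ∃ r : ℂ, Tendsto (fun k => star x ⬝ᵥ (Y k *ᵥ x)) atTop (𝓝 r) := by
    refine ⟨_, ((Complex.continuous_ofReal.tendsto _).comp (tendsto_atTop_ciInf (h x)
      ⟨0, Set.forall_mem_range.mpr fun k => (hY k).re_dotProduct_nonneg x⟩)).congr fun k => ?_⟩
    have := Complex.nonneg_iff.mp ((hY k).posSemidef.dotProduct_mulVec_nonneg x)
    exact Complex.ext (by simp) (by simpa using this.2)
  choose q hq using hq
  have hentry (i j : ι) : ∃ r : ℂ, Tendsto (fun k => Y k i j) atTop (𝓝 r) := by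
    refine ⟨_, Tendsto.congr (fun k => ?_)
      (((((hq (Pi.single i 1 + Pi.single j 1)).sub (hq (Pi.single i 1 - Pi.single j 1))).sub
        ((hq (Pi.single i 1 + Complex.I • Pi.single j 1)).const_mul Complex.I)).add
        ((hq (Pi.single i 1 - Complex.I • Pi.single j 1)).const_mul Complex.I)).div_const 4)⟩
    rw [← polarization]
    simp [Pi.star_single]
  choose L hL using hentry
  exact ⟨Matrix.of L, tendsto_pi_nhds.mpr fun i => tendsto_pi_nhds.mpr fun j => hL i j⟩

/-- The iteration `Y ↦ 1 - Bᴴ Y⁻¹ B` started at `1`. -/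
noncomputable def riccatiSeq (B : Matrix ι ι ℂ) : ℕ → Matrix ι ι ℂ
  | 0 => 1
  | k + 1 => 1 - Bᴴ * (riccatiSeq B k)⁻¹ * B

theorem re_dotProduct_one_sub_mulVec (Y B : Matrix ι ι ℂ) (v : ι → ℂ) :
    (star v ⬝ᵥ ((1 - Bᴴ * Y⁻¹ * B) *ᵥ v)).re =
      (star v ⬝ᵥ v).re - (star (B *ᵥ v) ⬝ᵥ (Y⁻¹ *ᵥ (B *ᵥ v))).re := by
  rw [sub_mulVec, one_mulVec, dotProduct_sub, Complex.sub_re, ← mulVec_mulVec, ← mulVec_mulVec,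
    dotProduct_mulVec (star v) Bᴴ, ← star_mulVec]

theorem isHermitian_riccatiSeq (B : Matrix ι ι ℂ) (k : ℕ) : (riccatiSeq B k).IsHermitian := by
  induction k with
  | zero => exact isHermitian_one
  | succ k ih => exact isHermitian_one.sub (isHermitian_conjTranspose_mul_mul B ih.inv)

/-- The third clause realizes the Schur complement by an explicit tail; it implies the other two at
the same `k`, so it alone needs induction. -/
theorem riccatiSeq_bound {B : Matrix ι ι ℂ} (hB : IsUnit B)
    (hω : ∀ x : ι → ℂ, ‖star x ⬝ᵥ (B *ᵥ x)‖ ≤ 1 / 2 * (star x ⬝ᵥ x).re) (k : ℕ) :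
    (riccatiSeq B k).PosDef ∧
      (∀ v, (star (Bᴴ *ᵥ v) ⬝ᵥ (Bᴴ *ᵥ v)).re ≤ (star v ⬝ᵥ (riccatiSeq B k *ᵥ v)).re) ∧
      ∀ v, ∃ x, x 0 = v ∧ toeplitzForm B k x = (star v ⬝ᵥ (riccatiSeq B k *ᵥ v)).re := by
  have main (k : ℕ) (hx : ∀ v, ∃ x, x 0 = v ∧
      toeplitzForm B k x = (star v ⬝ᵥ (riccatiSeq B k *ᵥ v)).re) :
      (riccatiSeq B k).PosDef ∧
        ∀ v, (star (Bᴴ *ᵥ v) ⬝ᵥ (Bᴴ *ᵥ v)).re ≤ (star v ⬝ᵥ (riccatiSeq B k *ᵥ v)).re := by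
    have hle (v : ι → ℂ) :
        (star (Bᴴ *ᵥ v) ⬝ᵥ (Bᴴ *ᵥ v)).re ≤ (star v ⬝ᵥ (riccatiSeq B k *ᵥ v)).re := by
      obtain ⟨x, hx0, hx⟩ := hx v
      -- Prepending `-Bᴴ v` adds `‖Bᴴ v‖² - 2‖Bᴴ v‖²` to the form.
      have h := toeplitzForm_nonneg hω (k + 1) (fun j => Nat.casesOn j (-(Bᴴ *ᵥ v)) x)
      rw [toeplitzForm_succ] at h
      change 0 ≤ (star (-(Bᴴ *ᵥ v)) ⬝ᵥ -(Bᴴ *ᵥ v)).re +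
        2 * (star (x 0) ⬝ᵥ (B *ᵥ -(Bᴴ *ᵥ v))).re + toeplitzForm B k x at h
      have hv : star (Bᴴ *ᵥ v) = star v ᵥ* B := by rw [star_mulVec, conjTranspose_conjTranspose]
      rw [hx, hx0, dotProduct_mulVec (star v) B, ← hv] at h
      simp only [star_neg, neg_dotProduct, dotProduct_neg, neg_neg, Complex.neg_re] at h
      linarith
    refine ⟨(isHermitian_riccatiSeq B k).posDef_of_re_pos fun v hv =>
      (re_star_dotProduct_self_pos fun h0 => hv ?_).trans_le (hle v), hle⟩
    exact (mulVec_injective_iff_isUnit.mpr hB.star) (by simpa [star_eq_conjTranspose] using h0)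
  suffices h : ∀ v, ∃ x, x 0 = v ∧
      toeplitzForm B k x = (star v ⬝ᵥ (riccatiSeq B k *ᵥ v)).re from
    ⟨(main k h).1, (main k h).2, h⟩
  induction k with
  | zero => exact fun v => ⟨fun _ => v, rfl, by simp [toeplitzForm, riccatiSeq]⟩
  | succ k ih =>
    intro v
    have hY := (main k ih).1
    have hdet := (isUnit_iff_isUnit_det _).mp hY.isUnit
    -- With `Y` the `k`-th iterate, this is the minimizer of `w ↦ 2 Re (w*Bv) + w*Yw`.
    obtain ⟨x, hx0, hx⟩ := ih (-((riccatiSeq B k)⁻¹ *ᵥ (B *ᵥ v)))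
    refine ⟨fun j => Nat.casesOn j v x, rfl, ?_⟩
    rw [toeplitzForm_succ]
    change (star v ⬝ᵥ v).re + 2 * (star (x 0) ⬝ᵥ (B *ᵥ v)).re + toeplitzForm B k x = _
    rw [hx, hx0, riccatiSeq, re_dotProduct_one_sub_mulVec, re_star_dotProduct_comm (B *ᵥ v),
      mulVec_neg, mulVec_mulVec _ (riccatiSeq B k), mul_nonsing_inv _ hdet, one_mulVec]
    simp only [star_neg, neg_dotProduct, dotProduct_neg, neg_neg, Complex.neg_re]
    ring

/-- Inversion reverses order, so the iteration map is monotone, and its first step descends from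
`1`. -/
theorem antitone_riccatiSeq {B : Matrix ι ι ℂ} (hpos : ∀ k, (riccatiSeq B k).PosDef)
    (x : ι → ℂ) : Antitone fun k => (star x ⬝ᵥ (riccatiSeq B k *ᵥ x)).re := by
  refine antitone_nat_of_succ_le fun k => ?_
  induction k generalizing x with
  | zero =>
    conv_lhs => rw [riccatiSeq, re_dotProduct_one_sub_mulVec]
    simp only [riccatiSeq, one_mulVec, inv_one]
    linarith [re_star_dotProduct_self_nonneg (B *ᵥ x)]
  | succ k ih =>
    rw [riccatiSeq, re_dotProduct_one_sub_mulVec]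
    conv_rhs => rw [riccatiSeq, re_dotProduct_one_sub_mulVec]
    linarith [(hpos k).re_dotProduct_inv_antitone (hpos (k + 1)) ih (B *ᵥ x)]

/-- If `B` is invertible with numerical radius at most `1 / 2`, then `Y + Bᴴ Y⁻¹ B = 1` has a
positive definite solution, which moreover is the limit of the fixed-point iteration. -/
theorem exists_posDef_solution {B : Matrix ι ι ℂ} (hB : IsUnit B)
    (hω : ∀ x : ι → ℂ, ‖star x ⬝ᵥ (B *ᵥ x)‖ ≤ 1 / 2 * (star x ⬝ᵥ x).re) :
    ∃ Y : Matrix ι ι ℂ, Y.PosDef ∧ Y + Bᴴ * Y⁻¹ * B = 1 ∧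
      Tendsto (riccatiSeq B) atTop (𝓝 Y) := by
  have hpos (k : ℕ) := (riccatiSeq_bound hB hω k).1
  obtain ⟨L, hL⟩ := exists_tendsto_of_antitone_form hpos (antitone_riccatiSeq hpos)
  have hherm : L.IsHermitian :=
    tendsto_nhds_unique (((continuous_id.matrix_conjTranspose.tendsto L).comp hL).congr
      fun k => (hpos k).isHermitian) hL
  -- The bound uniform in `k` keeps the limit from being singular, so inversion is continuous there.
  have hform (v : ι → ℂ) : (star (Bᴴ *ᵥ v) ⬝ᵥ (Bᴴ *ᵥ v)).re ≤ (star v ⬝ᵥ (L *ᵥ v)).re := by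
    have hcont : Continuous fun M : Matrix ι ι ℂ => (star v ⬝ᵥ (M *ᵥ v)).re :=
      Complex.continuous_re.comp
        (continuous_const.dotProduct (continuous_id.matrix_mulVec continuous_const))
    exact ge_of_tendsto' ((hcont.tendsto L).comp hL) fun k => (riccatiSeq_bound hB hω k).2.1 v
  have hLpos : L.PosDef := hherm.posDef_of_re_pos fun v hv =>
    (re_star_dotProduct_self_pos fun h0 => hv
      ((mulVec_injective_iff_isUnit.mpr hB.star)
        (by simpa [star_eq_conjTranspose] using h0))).trans_le (hform v)
  have hdet : L.det ≠ 0 := ((isUnit_iff_isUnit_det L).mp hLpos.isUnit).ne_zero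
  have hinv : Tendsto (fun M : Matrix ι ι ℂ => M⁻¹) (𝓝 L) (𝓝 L⁻¹) := by
    simp only [Matrix.inv_def, Ring.inverse_eq_inv']
    exact ((continuous_id.matrix_det.tendsto L).inv₀ hdet).smul
      (continuous_id.matrix_adjugate.tendsto L)
  have hcont : Continuous fun M : Matrix ι ι ℂ => 1 - Bᴴ * M * B :=
    continuous_const.sub ((continuous_const.matrix_mul continuous_id).matrix_mul continuous_const)
  have hstep : Tendsto (fun k => riccatiSeq B (k + 1)) atTop (𝓝 (1 - Bᴴ * L⁻¹ * B)) :=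
    ((hcont.tendsto _).comp hinv).comp hL
  have heq := tendsto_nhds_unique (hL.comp (tendsto_add_atTop_nat 1)) hstep
  exact ⟨L, hLpos, eq_sub_iff_add_eq.mp heq, hL⟩

end Riccati

/-! ### The real representation and the reduction to `lozenge A`. -/

section RealRepresentation

open Filter Topology

variable {ι : Type*}

/-- The real representation `[Re X, -Im X; Im X, Re X]` of a complex matrix, with its entries
regarded as complex numbers. -/
noncomputable def realRep (X : Matrix ι ι ℂ) : Matrix (ι ⊕ ι) (ι ⊕ ι) ℂ :=
  Matrix.fromBlocks (X.map fun z => (z.re : ℂ)) (X.map fun z => -(z.im : ℂ))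
    (X.map fun z => (z.im : ℂ)) (X.map fun z => (z.re : ℂ))

/-- A left inverse of `realRep`. -/
noncomputable def ofRealRep (Z : Matrix (ι ⊕ ι) (ι ⊕ ι) ℂ) : Matrix ι ι ℂ :=
  Matrix.of fun i j => ⟨(Z (.inl i) (.inl j)).re, (Z (.inr i) (.inl j)).re⟩

theorem ofRealRep_realRep (X : Matrix ι ι ℂ) : ofRealRep (realRep X) = X := by
  ext i j; apply Complex.ext <;> simp [ofRealRep, realRep]

theorem realRep_injective : Function.Injective (realRep (ι := ι)) :=
  Function.LeftInverse.injective ofRealRep_realRep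

theorem continuous_realRep : Continuous (realRep (ι := ι)) := by
  unfold realRep
  refine Continuous.matrix_fromBlocks ?_ ?_ ?_ ?_ <;>
    exact continuous_id.matrix_map (by fun_prop)

theorem continuous_ofRealRep : Continuous (ofRealRep (ι := ι)) := by
  refine continuous_matrix fun i j => ?_
  have h (a b : ι ⊕ ι) : Continuous fun Z : Matrix (ι ⊕ ι) (ι ⊕ ι) ℂ => ((Z a b).re : ℂ) :=
    Complex.continuous_ofReal.comp (Complex.continuous_re.comp (continuous_id.matrix_elem a b))
  refine ((h (.inl i) (.inl j)).add ((h (.inr i) (.inl j)).mul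
    (continuous_const (y := Complex.I)))).congr fun Z => ?_
  exact Complex.ext (by simp [ofRealRep]) (by simp [ofRealRep])

/-- The range is the fixed-point set of the continuous map `realRep ∘ ofRealRep`. -/
theorem isClosed_range_realRep : IsClosed (Set.range (realRep (ι := ι))) := by
  have : Set.range (realRep (ι := ι)) = {Z | realRep (ofRealRep Z) = Z} := by
    ext Z
    exact ⟨by rintro ⟨X, rfl⟩; exact congrArg realRep (ofRealRep_realRep X), fun h => ⟨_, h⟩⟩
  rw [this]
  exact isClosed_eq (continuous_realRep.comp continuous_ofRealRep) continuous_id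

theorem realRep_add (X Y : Matrix ι ι ℂ) : realRep (X + Y) = realRep X + realRep Y := by
  ext (i | i) (j | j) <;> simp [realRep, add_comm]

theorem realRep_sub (X Y : Matrix ι ι ℂ) : realRep (X - Y) = realRep X - realRep Y := by
  ext (i | i) (j | j) <;> (simp [realRep]; try ring)

theorem realRep_conjTranspose (X : Matrix ι ι ℂ) : realRep Xᴴ = (realRep X)ᴴ := by
  ext (i | i) (j | j) <;> simp [realRep]

variable [DecidableEq ι]

theorem realRep_one : realRep (1 : Matrix ι ι ℂ) = 1 := by
  ext (i | i) (j | j) <;> by_cases h : i = j <;> simp [realRep, h, Matrix.one_apply]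

variable [Fintype ι]

omit [DecidableEq ι] in
theorem realRep_mul (X Y : Matrix ι ι ℂ) : realRep (X * Y) = realRep X * realRep Y := by
  ext (i | i) (j | j) <;>
    simp [realRep, Matrix.mul_apply, Complex.re_sum, Complex.im_sum,
      Finset.sum_add_distrib, Finset.sum_sub_distrib] <;> ring

theorem realRep_inv {X : Matrix ι ι ℂ} (hX : IsUnit X) : realRep X⁻¹ = (realRep X)⁻¹ := by
  refine (inv_eq_right_inv ?_).symm
  rw [← realRep_mul, mul_nonsing_inv _ ((isUnit_iff_isUnit_det X).mp hX), realRep_one]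

theorem isUnit_realRep {X : Matrix ι ι ℂ} (hX : IsUnit X) : IsUnit (realRep X) := by
  refine IsUnit.of_mul_eq_one (realRep X⁻¹) ?_
  rw [← realRep_mul, mul_nonsing_inv _ ((isUnit_iff_isUnit_det X).mp hX), realRep_one]

open scoped MatrixOrder in
theorem posDef_realRep {X : Matrix ι ι ℂ} (hX : X.PosDef) : (realRep X).PosDef := by
  obtain ⟨C, hC⟩ : ∃ C, X = Cᴴ * C := by
    refine ⟨CFC.sqrt X, ?_⟩
    rw [(CFC.sqrt_nonneg X).posSemidef.isHermitian.eq,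
      CFC.sqrt_mul_sqrt_self X hX.posSemidef.nonneg]
  have hCu : IsUnit C := by
    have := hX.isUnit
    rw [hC] at this
    exact isUnit_of_mul_isUnit_right this
  rw [hC, realRep_mul, realRep_conjTranspose]
  exact .conjTranspose_mul_self _ (mulVec_injective_iff_isUnit.mpr (isUnit_realRep hCu))

omit [DecidableEq ι] in
-- On the vectors `(v, -iv)` the real representation acts as `X`; its form there is `2 v*Xv`, which
-- transfers positivity back to `X`.
theorem realRep_mulVec (X : Matrix ι ι ℂ) (v : ι → ℂ) :
    realRep X *ᵥ Sum.elim v (-(Complex.I • v)) =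
      Sum.elim (X *ᵥ v) (-(Complex.I • (X *ᵥ v))) := by
  have hre (M : Matrix ι ι ℂ) : M = M.map (fun z => (z.re : ℂ)) +
      Complex.I • M.map (fun z => (z.im : ℂ)) := by
    ext i j
    simp [mul_comm Complex.I, Complex.re_add_im]
  have hneg : (X.map fun z => -(z.im : ℂ)) = -X.map fun z => (z.im : ℂ) := by ext; simp
  rw [realRep, fromBlocks_mulVec, hneg]
  conv_rhs => rw [hre X]
  congr 1
  · simp [mulVec_neg, neg_mulVec, add_mulVec, mulVec_smul, smul_mulVec]
  · simp [mulVec_neg, add_mulVec, mulVec_smul, smul_mulVec, smul_smul]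

omit [DecidableEq ι] in
theorem posDef_of_posDef_realRep {X : Matrix ι ι ℂ} (hX : (realRep X).PosDef) : X.PosDef := by
  have hherm : X.IsHermitian := by
    apply realRep_injective
    rw [realRep_conjTranspose]
    exact hX.isHermitian
  refine hherm.posDef_of_re_pos fun v hv => ?_
  have hw : Sum.elim v (-(Complex.I • v)) ≠ 0 := fun h =>
    hv (funext fun i => congrFun h (.inl i))
  have h := (Complex.pos_iff.mp (hX.dotProduct_mulVec_pos hw)).1
  rw [realRep_mulVec] at h
  have hstar : star (Sum.elim v (-(Complex.I • v))) = Sum.elim (star v) (Complex.I • star v) := by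
    ext (i | i) <;> simp
  rw [hstar, sumElim_dotProduct_sumElim] at h
  simp [← mul_assoc] at h
  linarith

/-- The complexification of `lozenge A`. -/
noncomputable abbrev lozengeC (A : Matrix ι ι ℂ) : Matrix (ι ⊕ ι) (ι ⊕ ι) ℂ :=
  (lozenge A).map Complex.ofReal

theorem lozengeC_eq (A : Matrix ι ι ℂ) :
    lozengeC A = fromBlocks 0 1 1 0 * realRep A := by
  rw [realRep, fromBlocks_multiply]
  ext (i | i) (j | j) <;> simp [lozenge]

theorem swap_mul_realRep_mul_swap (X : Matrix ι ι ℂ) :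
    fromBlocks 0 1 1 0 * realRep X * fromBlocks 0 1 1 0 =
      realRep (X.map (starRingEnd ℂ)) := by
  rw [realRep, fromBlocks_multiply, fromBlocks_multiply]
  ext (i | i) (j | j) <;> simp [realRep]

theorem isUnit_lozengeC {A : Matrix ι ι ℂ} (hA : IsUnit A) : IsUnit (lozengeC A) := by
  rw [lozengeC_eq]
  refine IsUnit.mul (IsUnit.of_mul_eq_one (fromBlocks 0 1 1 0) ?_) (isUnit_realRep hA)
  simp [fromBlocks_multiply]

theorem map_conj_inv {X : Matrix ι ι ℂ} (hX : IsUnit X) :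
    (X.map (starRingEnd ℂ))⁻¹ = X⁻¹.map (starRingEnd ℂ) := by
  refine inv_eq_right_inv ?_
  rw [← Matrix.map_mul, mul_nonsing_inv _ ((isUnit_iff_isUnit_det X).mp hX),
    Matrix.map_one _ (map_zero _) (map_one _)]

theorem lozengeC_conjTranspose_mul_inv_mul (A : Matrix ι ι ℂ) {X : Matrix ι ι ℂ}
    (hX : IsUnit X) :
    (lozengeC A)ᴴ * (realRep X)⁻¹ * lozengeC A =
      realRep (Aᴴ * (X.map (starRingEnd ℂ))⁻¹ * A) := by
  have hK : (fromBlocks 0 1 1 0 : Matrix (ι ⊕ ι) (ι ⊕ ι) ℂ)ᴴ = fromBlocks 0 1 1 0 := by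
    simp [fromBlocks_conjTranspose]
  rw [map_conj_inv hX, realRep_mul, realRep_mul, ← swap_mul_realRep_mul_swap, realRep_inv hX,
    lozengeC_eq, conjTranspose_mul, hK, realRep_conjTranspose]
  simp only [Matrix.mul_assoc]

theorem numericalRadius_le_half_iff {κ : Type*} [Fintype κ] (M : Matrix κ κ ℂ) :
    numericalRadius M ≤ 1 / 2 ↔
      ∀ x : κ → ℂ, ‖star x ⬝ᵥ (M *ᵥ x)‖ ≤ 1 / 2 * (star x ⬝ᵥ x).re := by
  have hnorm (x : EuclideanSpace ℂ κ) : (star x.ofLp ⬝ᵥ x.ofLp).re = ‖x‖ ^ 2 := by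
    rw [dotProduct_comm, ← EuclideanSpace.inner_eq_star_dotProduct,
      inner_self_eq_norm_sq_to_K]
    norm_cast
  constructor
  · intro h x
    rcases eq_or_ne x 0 with rfl | hx
    · simp
    have : Nonempty κ := by
      obtain ⟨i, -⟩ := Function.ne_iff.mp hx
      exact ⟨i⟩
    set y : EuclideanSpace ℂ κ := WithLp.toLp 2 x with hy
    have hy0 : 0 < ‖y‖ := norm_pos_iff.mpr fun h0 => hx (by simpa [hy] using h0)
    set c : ℂ := ((‖y‖⁻¹ : ℝ) : ℂ) with hc
    have hmem : ‖star (c • y).ofLp ⬝ᵥ (M *ᵥ (c • y).ofLp)‖ ∈ numericalRangeModuli M :=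
      ⟨c • y, by rw [norm_smul, hc, Complex.norm_real, Real.norm_of_nonneg (by positivity),
        inv_mul_cancel₀ hy0.ne'], rfl⟩
    have hle := ((isGreatest_numericalRadius M).2 hmem).trans h
    rw [WithLp.ofLp_smul, star_smul, mulVec_smul, smul_dotProduct, dotProduct_smul, norm_smul,
      norm_smul, norm_star, hc, Complex.norm_real, Real.norm_of_nonneg (by positivity)] at hle
    rw [show star x ⬝ᵥ x = star y.ofLp ⬝ᵥ y.ofLp from rfl, hnorm]
    change _ * (_ * ‖star x ⬝ᵥ (M *ᵥ x)‖) ≤ _ at hle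
    calc ‖star x ⬝ᵥ (M *ᵥ x)‖
        = (‖y‖⁻¹ * (‖y‖⁻¹ * ‖star x ⬝ᵥ (M *ᵥ x)‖)) * ‖y‖ ^ 2 := by field_simp
      _ ≤ 1 / 2 * ‖y‖ ^ 2 := by gcongr
  · intro h
    -- The side goal `0 ≤ 1 / 2` covers an empty index type, where `sSup ∅ = 0`.
    refine Real.sSup_le ?_ (by norm_num)
    rintro r ⟨x, hx, rfl⟩
    have := h x.ofLp
    rwa [hnorm, hx, one_pow, mul_one] at this

/-- Under `realRep` the iteration is `X ↦ 1 - Aᴴ X̄⁻¹ A`, started at `1`. -/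
theorem riccatiSeq_lozengeC_mem_range {A : Matrix ι ι ℂ}
    (hpos : ∀ k, (riccatiSeq (lozengeC A) k).PosDef) (k : ℕ) :
    riccatiSeq (lozengeC A) k ∈ Set.range (realRep (ι := ι)) := by
  induction k with
  | zero => exact ⟨1, realRep_one⟩
  | succ k ih =>
    obtain ⟨X, hX⟩ := ih
    have hXpos : X.PosDef := posDef_of_posDef_realRep (hX ▸ hpos k)
    refine ⟨1 - Aᴴ * (X.map (starRingEnd ℂ))⁻¹ * A, ?_⟩
    rw [riccatiSeq, ← hX, lozengeC_conjTranspose_mul_inv_mul A hXpos.isUnit, realRep_sub,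
      realRep_one]

end RealRepresentation

theorem mainTheorem8 (n : ℕ) (A : Matrix (Fin n) (Fin n) ℂ) (hA : IsUnit A) :
    (∃ X : Matrix (Fin n) (Fin n) ℂ,
        X.PosDef ∧ X + Aᴴ * (X.map (starRingEnd ℂ))⁻¹ * A = 1) ↔
      numericalRadius ((lozenge A).map Complex.ofReal) ≤ 1 / 2 := by
  rw [numericalRadius_le_half_iff]
  constructor
  · rintro ⟨X, hX, h⟩
    refine norm_dotProduct_le_of_solution (posDef_realRep hX) ?_
    rw [lozengeC_conjTranspose_mul_inv_mul A hX.isUnit, ← realRep_add, h, realRep_one]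
  · intro h
    obtain ⟨Y, hY, heq, hlim⟩ := exists_posDef_solution (isUnit_lozengeC hA) h
    obtain ⟨X, rfl⟩ := isClosed_range_realRep.mem_of_tendsto hlim (.of_forall fun k =>
      riccatiSeq_lozengeC_mem_range
        (fun k => (riccatiSeq_bound (isUnit_lozengeC hA) h k).1) k)
    have hX := posDef_of_posDef_realRep hY
    refine ⟨X, hX, realRep_injective ?_⟩
    rw [realRep_add, ← lozengeC_conjTranspose_mul_inv_mul A hX.isUnit, realRep_one]
    exact heq
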